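/- Let $m\ge 2$, $q=2^m$ and $u=2^{m-1}$. Let $\alpha$ be a primitive element of $\mathrm{GF}(q^2)$ (a generator of its multiplicative group) and put $\beta=\alpha^{q-1}$, a primitive $(q+1)$-th root of unity. Let $\mathbb{M}_{\beta^i}(x)$ be the minimal polynomial of $\beta^i$ over $\mathrm{GF}(q)$, let $g_u(x)=\prod_{i=u}^{\lfloor (q+1)/2\rfloor}\mathbb{M}_{\beta^i}(x)$ (here just $\mathbb{M}_{\beta^u}(x)$), and let $\mathcal{C}_u$ be the cyclic code of length $q+1$ over $\mathrm{GF}(q)$ with generator polynomial $g_u(x)$, i.e. the set of $(c_0,\dots,c_q)\in \mathrm{GF}(q)^{q+1}$ such that $\sum_i c_ix^i$ lies in the ideal generated by $g_u(x)$ in $\mathrm{GF}(q)[x]/(x^{q+1}-1)$. Let $$\overline{\mathcal{C}_u}=\Big\{(c_0,\dots,c_{q+1})\in\mathrm{GF}(q)^{q+2} : (c_0,\dots,c_q)\in\mathcal{C}_u,\ \sum_{i=0}^{q+1}c_i=0\Big\}$$ be its extended code, and let $\perp$ denote the Euclidean dual. An $[n,k,d]$ code over $\mathrm{GF}(q)$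 is a $k$-dimensional linear subspace of $\mathrm{GF}(q)^n$ with minimum Hamming distance $d$; it is MDS if $n,k\ge 1$ and $d=n-k+1$. A hyperoval code over $\mathrm{GF}(q)$ is a $[q+2,3,q]$ code. Then: 1. $\mathcal{C}_u$ is a $[q+1,q-1,3]$ MDS code over $\mathrm{GF}(q)$. 2. $(\mathcal{C}_u)^\perp$ is a $[q+1,2,q]$ MDS code over $\mathrm{GF}(q)$. 3. $\overline{\mathcal{C}_u}$ is a $[q+2,q-1,4]$ MDS code over $\mathrm{GF}(q)$. 4. $(\overline{\mathcal{C}_u})^\perp$ is a $[q+2,3,q]$ MDS code over $\mathrm{GF}(q)$, that is, an MDS hyperoval code. -/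

import Mathlib

open Polynomial

noncomputable section

/-- `C` is an `[n, k, d]` code over `F`: a `k`-dimensional linear subspace of `F ^ n` whose minimum
Hamming distance (the least distance between two distinct codewords) exists and equals `d`. -/
def IsLinearCode {F : Type*} [Field F] [DecidableEq F] (n k d : ℕ)
    (C : Submodule F (Fin n → F)) : Prop :=
  Module.finrank F C = k ∧
    IsLeast {t : ℕ | ∃ x ∈ C, ∃ y ∈ C, x ≠ y ∧ hammingDist x y = t} d

/-- An MDS code: an `[n, k, n - k + 1]` code with `n` and `k` positive. -/
def IsMDSCode {F : Type*} [Field F] [DecidableEq F] (n : ℕ)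
    (C : Submodule F (Fin n → F)) : Prop :=
  ∃ k d : ℕ, 0 < n ∧ 0 < k ∧ d + k = n + 1 ∧ IsLinearCode n k d C

/-- A hyperoval code over a field with `q` elements, `q = 2 ^ m`: a `[q + 2, 3, q]` code. -/
def IsHyperovalCode {F : Type*} [Field F] [DecidableEq F] (q : ℕ)
    (C : Submodule F (Fin (q + 2) → F)) : Prop :=
  Nat.card F = q ∧ (∃ m : ℕ, q = 2 ^ m) ∧ IsLinearCode (q + 2) 3 q C

/-- The (Euclidean) dual code. -/
def dualCode {F : Type*} [Field F] {n : ℕ} (C : Submodule F (Fin n → F)) :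
    Submodule F (Fin n → F) where
  carrier := {c | ∀ a ∈ C, a ⬝ᵥ c = 0}
  zero_mem' := fun a _ => dotProduct_zero a
  add_mem' := fun {x y} hx hy a ha => by
    rw [dotProduct_add, hx a ha, hy a ha, add_zero]
  smul_mem' := fun r x hx a ha => by
    rw [dotProduct_smul, hx a ha, smul_zero]

/-- The extended code: an overall parity check coordinate is appended, so that the coordinates of
every codeword sum to zero. -/
def extendedCode {F : Type*} [Field F] {n : ℕ} (C : Submodule F (Fin n → F)) :
    Submodule F (Fin (n + 1) → F) where
  carrier := {c | (fun i : Fin n => c i.castSucc) ∈ C ∧ ∑ i : Fin (n + 1), c i = 0}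
  zero_mem' := ⟨C.zero_mem, by simp⟩
  add_mem' := fun {x y} hx hy =>
    ⟨C.add_mem hx.1 hy.1, by
      simp only [Pi.add_apply, Finset.sum_add_distrib, hx.2, hy.2, add_zero]⟩
  smul_mem' := fun r x hx =>
    ⟨C.smul_mem r hx.1, by
      simp only [Pi.smul_apply, ← Finset.smul_sum, hx.2, smul_zero]⟩

/-- The polynomial `c₀ + c₁ x + ⋯ + c_{n-1} x ^ (n-1)` of a vector, as an `F`-linear map. -/
def codePoly (F : Type*) [Field F] (n : ℕ) : (Fin n → F) →ₗ[F] F[X] :=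
  ∑ i : Fin n, (Polynomial.monomial (i : ℕ)).comp (LinearMap.proj i)

/-- The cyclic code of length `n` generated by `g`: the vectors whose class in `F[x] / (x ^ n - 1)`
lies in the ideal generated by the class of `g`. -/
def cyclicCode {F : Type*} [Field F] (n : ℕ) (g : F[X]) : Submodule F (Fin n → F) :=
  ((Ideal.span {Ideal.Quotient.mk (Ideal.span {(X ^ n - 1 : F[X])}) g}).restrictScalars F).comap
    ((Ideal.Quotient.mkₐ F (Ideal.span {(X ^ n - 1 : F[X])})).toLinearMap.comp (codePoly F n))

/-- `g_u(x)`, the product of the minimal polynomials over `F` of `β ^ i`,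
for `u ≤ i ≤ ⌊(q + 1) / 2⌋`. -/
def genPoly (F : Type*) {K : Type*} [Field F] [Field K] [Algebra F K] (q u : ℕ) (β : K) : F[X] :=
  ∏ i ∈ Finset.Icc u ((q + 1) / 2), minpoly F (β ^ i)

/-- The code `C_u`: the cyclic code of length `q + 1` over `F` with generator polynomial `g_u`. -/
def codeC (F : Type*) {K : Type*} [Field F] [Field K] [Algebra F K] (q u : ℕ) (β : K) :
    Submodule F (Fin (q + 1) → F) :=
  cyclicCode (q + 1) (genPoly F q u β)

end

/-! Put `γ = β ^ u`. Since `q = 2 * u`, both `u` and `2` are prime to `q + 1`, so `γ` and `γ ^ 2`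
are primitive `(q + 1)`-th roots of unity, and `C_u` has parity check columns `γ ^ i` in the plane
`K` over `F`. Frobenius inverts each `γ ^ i`: these points form a unit circle. A line through the
origin meets it at most once (`eq_zero_of_unitCircle_pair`), and no three of its points are
collinear (`eq_zero_of_unitCircle_triple`).

Extending the code replaces the columns by `(γ ^ i, 1)` and `(0, 1)` in `K × F`: a conic with its
nucleus, hence a hyperoval. So any two, respectively three, columns are independent in a space of
exactly that dimension, which makes the kernel code and its dual MDS. -/

/-! ### Codes from parity check columns, and their duals -/

section KernelCode

variable {F V : Type*} [Field F] [AddCommGroup V] [Module F V]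

/-- The code with parity check columns `h i`: the vectors `c` with `∑ i, c i • h i = 0`. -/
def kernelCode {n : ℕ} (h : Fin n → V) : Submodule F (Fin n → F) :=
  LinearMap.ker (Fintype.linearCombination F h)

lemma mem_kernelCode {n : ℕ} {h : Fin n → V} {c : Fin n → F} :
    c ∈ kernelCode h ↔ ∑ i, c i • h i = 0 := by
  simp [kernelCode, Fintype.linearCombination_apply]

/-- Any `r` of the columns `h i` are linearly independent. -/
def AnyIndependent (F : Type*) {V : Type*} [Field F] [AddCommGroup V] [Module F V]
    (r : ℕ) {n : ℕ} (h : Fin n → V) : Prop :=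
  ∀ f : Fin r → Fin n, Function.Injective f → LinearIndependent F (h ∘ f)

lemma isLinearCode_of_weights [DecidableEq F] {n k d : ℕ} {C : Submodule F (Fin n → F)}
    (hk : Module.finrank F C = k)
    (hd : ∀ x ∈ C, x ≠ 0 → d ≤ hammingNorm x)
    (hex : ∃ x ∈ C, x ≠ 0 ∧ hammingNorm x ≤ d) : IsLinearCode n k d C := by
  refine ⟨hk, ?_, ?_⟩
  · obtain ⟨x, hx, hx0, hxd⟩ := hex
    exact ⟨x, hx, 0, C.zero_mem, hx0, by
      rw [hammingDist_zero_right]; exact le_antisymm hxd (hd x hx hx0)⟩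
  · rintro t ⟨x, hx, y, hy, hxy, rfl⟩
    rw [hammingDist_comm, hammingDist_eq_hammingNorm, neg_add_eq_sub]
    exact hd _ (C.sub_mem hx hy) (sub_ne_zero.mpr hxy)

variable {n r : ℕ} {h : Fin n → V}

/-- The evaluation map sending a functional `φ` to the vector of its values `φ (h i)`. -/
def evalMap (F : Type*) {V : Type*} [Field F] [AddCommGroup V] [Module F V] {n : ℕ}
    (h : Fin n → V) : Module.Dual F V →ₗ[F] (Fin n → F) :=
  LinearMap.pi fun i => Module.Dual.eval F V (h i)

@[simp] lemma evalMap_apply (φ : Module.Dual F V) (i : Fin n) : evalMap F h φ i = φ (h i) := rfl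

lemma dualCode_kernelCode : dualCode (kernelCode (F := F) h) = LinearMap.range (evalMap F h) := by
  ext c
  constructor
  · intro hc
    -- Read as a functional on `F ^ n`, `c` kills the kernel of `a ↦ ∑ i, a i • h i`, so it factors
    -- through that map.
    have hmem : Fintype.linearCombination F c ∈
        LinearMap.range (Fintype.linearCombination F h).dualMap := by
      rw [LinearMap.range_dualMap_eq_dualAnnihilator_ker, Submodule.mem_dualAnnihilator]
      intro a ha
      exact hc a ha
    obtain ⟨φ, hφ⟩ := hmem
    refine ⟨φ, funext fun i => ?_⟩
    simpa using LinearMap.congr_fun hφ (Pi.single i 1)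
  · rintro ⟨φ, rfl⟩ a ha
    have := congrArg φ (mem_kernelCode.mp ha)
    simpa [dotProduct] using this

lemma exists_injective_range_of_card_le {s : Finset (Fin n)} (hs : s.card ≤ r) (hrn : r ≤ n) :
    ∃ f : Fin r → Fin n, Function.Injective f ∧ ∀ i ∈ s, i ∈ Set.range f := by
  obtain ⟨t, hst, ht⟩ := Finset.exists_superset_card_eq hs (by simpa using hrn)
  exact ⟨t.orderEmbOfFin ht, (t.orderEmbOfFin ht).injective, fun i hi => by
    rw [Finset.range_orderEmbOfFin]; exact hst hi⟩

/-- A nonzero word of weight at most `r`, its support padded to `r` positions, would be a relation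
among `r` columns. -/
lemma AnyIndependent.lt_hammingNorm [DecidableEq F] (hh : AnyIndependent F r h) (hrn : r ≤ n)
    {c : Fin n → F} (hc : c ∈ kernelCode h) (hc0 : c ≠ 0) : r < hammingNorm c := by
  by_contra! hle
  obtain ⟨f, hf, hs⟩ := exists_injective_range_of_card_le (s := {i | c i ≠ 0}) hle hrn
  have hoff : ∀ i, i ∉ Set.range f → c i = 0 := fun i hi => by
    by_contra hne
    exact hi (hs i (by simpa using hne))
  have hsum : ∑ k, c (f k) • (h ∘ f) k = 0 := by
    rw [← mem_kernelCode.mp hc]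
    exact Fintype.sum_of_injective f hf _ _
      (fun i hi => by rw [hoff i hi, zero_smul]) fun _ => rfl
  have hz := Fintype.linearIndependent_iff.mp (hh f hf) _ hsum
  refine hc0 (funext fun i => ?_)
  by_cases hi : i ∈ Set.range f
  · obtain ⟨k, rfl⟩ := hi
    exact hz k
  · exact hoff i hi

variable [FiniteDimensional F V]

lemma AnyIndependent.span_eq_top (hh : AnyIndependent F r h) (hr : Module.finrank F V = r)
    {f : Fin r → Fin n} (hf : Function.Injective f) :
    Submodule.span F (Set.range (h ∘ f)) = ⊤ :=
  (hh f hf).span_eq_top_of_card_eq_finrank' (by simp [hr])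

lemma AnyIndependent.linearCombination_surjective (hh : AnyIndependent F r h)
    (hr : Module.finrank F V = r) (hrn : r ≤ n) :
    Function.Surjective (Fintype.linearCombination F h) := by
  rw [← LinearMap.range_eq_top, Fintype.range_linearCombination, eq_top_iff,
    ← hh.span_eq_top hr (Fin.castLE_injective hrn)]
  exact Submodule.span_mono (Set.range_comp_subset_range _ _)

lemma AnyIndependent.finrank_kernelCode (hh : AnyIndependent F r h)
    (hr : Module.finrank F V = r) (hrn : r ≤ n) :
    Module.finrank F (kernelCode (F := F) h) = n - r := by
  have h1 := LinearMap.finrank_range_add_finrank_ker (Fintype.linearCombination F h)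
  rw [LinearMap.range_eq_top.mpr (hh.linearCombination_surjective hr hrn), finrank_top, hr] at h1
  simp only [Module.finrank_fin_fun] at h1
  unfold kernelCode
  omega

lemma exists_mem_kernelCode_hammingNorm_le [DecidableEq F] (hr : Module.finrank F V = r)
    (hrn : r < n) : ∃ c ∈ kernelCode (F := F) h, c ≠ 0 ∧ hammingNorm c ≤ r + 1 := by
  -- `r < n` unfolds to `r + 1 ≤ n`, so these are the first `r + 1` columns, too many for dimension
  -- `r`.
  have hdep : ¬ LinearIndependent F (h ∘ Fin.castLE hrn) := fun hli => by
    have := hli.fintype_card_le_finrank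
    simp [hr] at this
  obtain ⟨g, hg, k, hk⟩ := Fintype.not_linearIndependent_iff.mp hdep
  have hinj := Fin.castLE_injective hrn
  refine ⟨Function.extend (Fin.castLE hrn) g 0, ?_, ?_, ?_⟩
  · rw [mem_kernelCode, ← hg]
    symm
    refine Fintype.sum_of_injective _ hinj _ _ (fun i hi => ?_) (fun k => ?_)
    · rw [Function.extend_apply' _ _ _ hi, Pi.zero_apply, zero_smul]
    · rw [hinj.extend_apply, Function.comp_apply]
  · intro h0
    exact hk (by rw [← hinj.extend_apply g 0 k, h0, Pi.zero_apply])
  · calc hammingNorm (Function.extend (Fin.castLE hrn) g 0)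
        ≤ (Finset.univ.image (Fin.castLE hrn)).card := by
          refine Finset.card_le_card fun i hi => ?_
          by_contra hni
          refine (Finset.mem_filter.mp hi).2 (Function.extend_apply' _ _ _ fun ⟨k, hk⟩ => hni ?_)
          exact Finset.mem_image.mpr ⟨k, Finset.mem_univ _, hk⟩
      _ ≤ r + 1 := Finset.card_image_le.trans (by simp)

lemma AnyIndependent.isLinearCode_kernelCode [DecidableEq F] (hh : AnyIndependent F r h)
    (hr : Module.finrank F V = r) (hrn : r < n) :
    IsLinearCode n (n - r) (r + 1) (kernelCode (F := F) h) :=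
  isLinearCode_of_weights (hh.finrank_kernelCode hr hrn.le)
    (fun _ hx hx0 => hh.lt_hammingNorm hrn.le hx hx0)
    (exists_mem_kernelCode_hammingNorm_le hr hrn)

lemma AnyIndependent.eq_zero_of_vanishes (hh : AnyIndependent F r h)
    (hr : Module.finrank F V = r) {f : Fin r → Fin n} (hf : Function.Injective f)
    {φ : Module.Dual F V} (hφ : ∀ k, φ (h (f k)) = 0) : φ = 0 :=
  LinearMap.ext_on_range (hh.span_eq_top hr hf) hφ

lemma AnyIndependent.finrank_dualCode_kernelCode (hh : AnyIndependent F r h)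
    (hr : Module.finrank F V = r) (hrn : r ≤ n) :
    Module.finrank F (dualCode (kernelCode (F := F) h)) = r := by
  rw [dualCode_kernelCode, LinearMap.finrank_range_of_inj, Subspace.dual_finrank_eq, hr]
  rw [← LinearMap.ker_eq_bot, LinearMap.ker_eq_bot']
  exact fun φ hφ => hh.eq_zero_of_vanishes hr (Fin.castLE_injective hrn) fun k =>
    congrFun hφ (Fin.castLE hrn k)

lemma hammingNorm_add_card_zeros [DecidableEq F] (c : Fin n → F) :
    hammingNorm c + (Finset.univ.filter fun i => c i = 0).card = n := by
  have := Finset.card_filter_add_card_filter_not (s := Finset.univ) fun i => c i = 0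
  rw [Finset.card_univ, Fintype.card_fin] at this
  rw [add_comm]
  exact this

/-- Zeros of a dual word are columns in the kernel of a functional; `r` of them span `V` and would
force it to vanish. -/
lemma AnyIndependent.lt_hammingNorm_dual [DecidableEq F] (hh : AnyIndependent F r h)
    (hr : Module.finrank F V = r) {c : Fin n → F}
    (hc : c ∈ dualCode (kernelCode (F := F) h)) (hc0 : c ≠ 0) : n < hammingNorm c + r := by
  rw [dualCode_kernelCode] at hc
  obtain ⟨φ, rfl⟩ := hc
  by_contra! hle
  have hz := hammingNorm_add_card_zeros (evalMap F h φ)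
  obtain ⟨t, hts, ht⟩ := Finset.exists_subset_card_eq
    (show r ≤ (Finset.univ.filter fun i => evalMap F h φ i = 0).card by omega)
  refine hc0 ?_
  rw [hh.eq_zero_of_vanishes hr (t.orderEmbOfFin ht).injective (φ := φ) fun k =>
    (Finset.mem_filter.mp (hts (t.orderEmbOfFin_mem ht k))).2, map_zero]

/-- The first `r - 1` columns cannot span, so some nonzero functional kills them all. -/
lemma AnyIndependent.exists_mem_dualCode_hammingNorm_le [DecidableEq F]
    (hh : AnyIndependent F r h) (hr : Module.finrank F V = r) (hr0 : 0 < r) (hrn : r ≤ n) :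
    ∃ c ∈ dualCode (kernelCode (F := F) h), c ≠ 0 ∧ hammingNorm c ≤ n + 1 - r := by
  have hle : r - 1 ≤ n := by omega
  have hlt : Submodule.span F (Set.range (h ∘ Fin.castLE hle)) < ⊤ := by
    refine lt_top_iff_ne_top.mpr fun htop => ?_
    have := finrank_range_le_card (R := F) (h ∘ Fin.castLE hle)
    rw [Set.finrank, htop, finrank_top, hr, Fintype.card_fin] at this
    omega
  obtain ⟨φ, hφ0, hφ⟩ := Submodule.exists_le_ker_of_lt_top _ hlt
  have hφz : ∀ k, φ (h (Fin.castLE hle k)) = 0 := fun k =>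
    hφ (Submodule.subset_span ⟨k, rfl⟩)
  refine ⟨evalMap F h φ, by rw [dualCode_kernelCode]; exact ⟨φ, rfl⟩, fun h0 => hφ0 ?_, ?_⟩
  · exact hh.eq_zero_of_vanishes hr (Fin.castLE_injective hrn) fun k => congrFun h0 _
  · have hz := hammingNorm_add_card_zeros (evalMap F h φ)
    have hcard : r - 1 ≤ (Finset.univ.filter fun i => evalMap F h φ i = 0).card := by
      calc r - 1 = (Finset.univ.map (Fin.castLEEmb hle)).card := by simp
        _ ≤ _ := Finset.card_le_card fun i hi => by
          obtain ⟨k, -, rfl⟩ := Finset.mem_map.mp hi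
          exact Finset.mem_filter.mpr ⟨Finset.mem_univ _, hφz k⟩
    omega

lemma AnyIndependent.isLinearCode_dualCode [DecidableEq F] (hh : AnyIndependent F r h)
    (hr : Module.finrank F V = r) (hr0 : 0 < r) (hrn : r ≤ n) :
    IsLinearCode n r (n + 1 - r) (dualCode (kernelCode (F := F) h)) :=
  isLinearCode_of_weights (hh.finrank_dualCode_kernelCode hr hrn)
    (fun _ hx hx0 => by have := hh.lt_hammingNorm_dual hr hx hx0; omega)
    (hh.exists_mem_dualCode_hammingNorm_le hr hr0 hrn)

end KernelCode

/-! ### Cyclic and extended codes as kernel codes -/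

section CyclicCode

variable {F K : Type*} [Field F] [Field K] [Algebra F K]

lemma codePoly_apply (n : ℕ) (c : Fin n → F) :
    codePoly F n c = ∑ i : Fin n, monomial (i : ℕ) (c i) := by
  simp [codePoly, LinearMap.sum_apply]

lemma aeval_codePoly (n : ℕ) (c : Fin n → F) (γ : K) :
    aeval γ (codePoly F n c) = ∑ i : Fin n, c i • γ ^ (i : ℕ) := by
  simp [codePoly_apply, aeval_monomial, Algebra.smul_def]

/-- For an `n`-th root of unity `γ`, the cyclic code generated by its minimal polynomial consists
of the vectors whose polynomial vanishes at `γ`. -/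
lemma cyclicCode_minpoly {n : ℕ} {γ : K} (hγ : γ ^ n = 1) :
    cyclicCode n (minpoly F γ) = kernelCode fun i : Fin n => γ ^ (i : ℕ) := by
  have hdvd : minpoly F γ ∣ X ^ n - 1 := minpoly.dvd F γ (by simp [hγ])
  ext c
  rw [mem_kernelCode, ← aeval_codePoly, ← minpoly.dvd_iff]
  change Ideal.Quotient.mk (Ideal.span {(X ^ n - 1 : F[X])}) (codePoly F n c) ∈
    Ideal.span {Ideal.Quotient.mk (Ideal.span {(X ^ n - 1 : F[X])}) (minpoly F γ)} ↔ _
  rw [Ideal.mem_span_singleton]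
  constructor
  · rintro ⟨b, hb⟩
    obtain ⟨b, rfl⟩ := Ideal.Quotient.mk_surjective b
    rw [← map_mul, Ideal.Quotient.mk_eq_mk_iff_sub_mem, Ideal.mem_span_singleton] at hb
    exact (dvd_sub_left (dvd_mul_right _ _)).mp (hdvd.trans hb)
  · exact fun hd => map_dvd _ hd

/-- The parity check columns of the extension of a code with columns `h`. -/
def extendedColumns (F : Type*) {V : Type*} [Field F] [AddCommGroup V] {n : ℕ}
    (h : Fin n → V) : Fin (n + 1) → V × F :=
  Fin.snoc (α := fun _ => V × F) (fun i => (h i, 1)) (0, 1)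

lemma extendedCode_kernelCode {V : Type*} [AddCommGroup V] [Module F V] {n : ℕ}
    (h : Fin n → V) :
    extendedCode (kernelCode (F := F) h) = kernelCode (extendedColumns F h) := by
  ext c
  rw [mem_kernelCode]
  change (_ ∈ kernelCode h ∧ _) ↔ _
  rw [mem_kernelCode, Fin.sum_univ_castSucc, Fin.sum_univ_castSucc]
  simp [extendedColumns, Prod.ext_iff, Prod.fst_sum, Prod.snd_sum]

end CyclicCode

/-! ### Independence of points on the unit circle -/

section UnitCircle

variable {F K : Type*} [Field F] [Field K] [Algebra F K]

/-- Two elements whose images under `σ` are their inverses are linearly independent as soon as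
their squares differ. -/
lemma eq_zero_of_unitCircle_pair (σ : K →ₐ[F] K) {x y : K} (hx : x * σ x = 1) (hy : y * σ y = 1)
    (hxy : x ^ 2 ≠ y ^ 2) {a b : F} (hab : a • x + b • y = 0) : a = 0 ∧ b = 0 := by
  have hσ : a • σ x + b • σ y = 0 := by simpa using congrArg σ hab
  rw [Algebra.smul_def, Algebra.smul_def] at hab hσ
  have hne : y ^ 2 - x ^ 2 ≠ 0 := sub_ne_zero.mpr hxy.symm
  constructor
  · have : algebraMap F K a * (y ^ 2 - x ^ 2) = 0 := by
      linear_combination x * y ^ 2 * hσ - x * hab - y ^ 2 * algebraMap F K a * hx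
        - x * y * algebraMap F K b * hy
    simpa [hne] using this
  · have : algebraMap F K b * (y ^ 2 - x ^ 2) = 0 := by
      linear_combination y * hab - x ^ 2 * y * hσ + x * y * algebraMap F K a * hx
        + x ^ 2 * algebraMap F K b * hy
    simpa [hne] using this

/-- Three distinct points of the unit circle (the elements whose images under `σ` are their
inverses) are affinely independent. -/
lemma eq_zero_of_unitCircle_triple (σ : K →ₐ[F] K) {x y z : K} (hx : x * σ x = 1)
    (hy : y * σ y = 1) (hz : z * σ z = 1) (hxy : x ≠ y) (hxz : x ≠ z) (hyz : y ≠ z) {a b c : F}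
    (h1 : a + b + c = 0) (h2 : a • x + b • y + c • z = 0) : a = 0 ∧ b = 0 ∧ c = 0 := by
  have key : ∀ {x y z : K}, x * σ x = 1 → y * σ y = 1 → z * σ z = 1 → x ≠ y → x ≠ z →
      ∀ {a b c : F}, a + b + c = 0 → a • x + b • y + c • z = 0 → a = 0 := by
    intro x y z hx hy hz hxy hxz a b c h1 h2
    have hσ : a • σ x + b • σ y + c • σ z = 0 := by simpa using congrArg σ h2
    have h1' : algebraMap F K a + algebraMap F K b + algebraMap F K c = 0 := by
      simpa using congrArg (algebraMap F K) h1
    rw [Algebra.smul_def, Algebra.smul_def, Algebra.smul_def] at h2 hσ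
    -- As `σ` inverts the points, `xyz * hσ` reads `a yz + b xz + c xy = 0`; the combination cancels
    -- `b` and `c`.
    have : algebraMap F K a * ((x - y) * (x - z)) = 0 := by
      linear_combination x * h2 - x * (y + z) * h1' + x * y * z * hσ
        - y * z * algebraMap F K a * hx - x * z * algebraMap F K b * hy
        - x * y * algebraMap F K c * hz
    simpa [sub_ne_zero.mpr hxy, sub_ne_zero.mpr hxz] using this
  exact ⟨key hx hy hz hxy hxz h1 h2,
    key hy hx hz hxy.symm hyz (a := b) (b := a) (c := c)
      (by linear_combination h1)
      (by linear_combination h2),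
    key hz hx hy hxz.symm hyz.symm (a := c) (b := a) (c := b)
      (by linear_combination h1)
      (by linear_combination h2)⟩

variable {n : ℕ} {h : Fin n → K}

lemma anyIndependent_two_of_unitCircle (σ : K →ₐ[F] K) (hσ : ∀ i, h i * σ (h i) = 1)
    (hsq : Function.Injective fun i => h i ^ 2) : AnyIndependent F 2 h := by
  intro f hf
  have hne : h (f 0) ^ 2 ≠ h (f 1) ^ 2 := fun he => by simpa using hf (hsq he)
  rw [Fintype.linearIndependent_iff]
  intro g hg
  rw [Fin.sum_univ_two] at hg
  simpa [Fin.forall_fin_two] using eq_zero_of_unitCircle_pair σ (hσ _) (hσ _) hne hg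

lemma anyIndependent_three_of_unitCircle (σ : K →ₐ[F] K) (hσ : ∀ i, h i * σ (h i) = 1)
    (hsq : Function.Injective fun i => h i ^ 2) :
    AnyIndependent F 3 (extendedColumns F h) := by
  intro f hf
  have hinj : ∀ {i j}, i ≠ j → h i ^ 2 ≠ h j ^ 2 := fun hij he => hij (hsq he)
  have hinj' : ∀ {i j}, i ≠ j → h i ≠ h j := fun hij he => hinj hij (by rw [he])
  have h01 : f 0 ≠ f 1 := hf.ne (by decide)
  have h02 : f 0 ≠ f 2 := hf.ne (by decide)
  have h12 : f 1 ≠ f 2 := hf.ne (by decide)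
  rw [Fintype.linearIndependent_iff]
  intro g hg
  rw [Fin.sum_univ_three, Function.comp_apply, Function.comp_apply, Function.comp_apply] at hg
  have hall : g 0 = 0 ∧ g 1 = 0 ∧ g 2 = 0 := by
    -- If one column is `(0, 1)`, the `K`-component is a relation between two circle points, and the
    -- `F`-component then kills the third coefficient.
    generalize f 0 = x, f 1 = y, f 2 = z at *
    induction x using Fin.lastCases with
    | last =>
      induction y using Fin.lastCases with
      | last => exact absurd rfl h01
      | cast j =>
        induction z using Fin.lastCases with
        | last => exact absurd rfl h02
        | cast k =>
          simp only [extendedColumns, Fin.snoc_castSucc, Fin.snoc_last, Prod.smul_mk,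
            Prod.mk_add_mk, Prod.mk_eq_zero, smul_zero, zero_add, smul_eq_mul, mul_one] at hg
          obtain ⟨h1, h2⟩ := eq_zero_of_unitCircle_pair σ (hσ _) (hσ _)
            (hinj fun he => h12 (by rw [he])) hg.1
          simpa [h1, h2] using hg.2
    | cast i =>
      induction y using Fin.lastCases with
      | last =>
        induction z using Fin.lastCases with
        | last => exact absurd rfl h12
        | cast k =>
          simp only [extendedColumns, Fin.snoc_castSucc, Fin.snoc_last, Prod.smul_mk,
            Prod.mk_add_mk, Prod.mk_eq_zero, smul_zero, add_zero, smul_eq_mul, mul_one] at hg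
          obtain ⟨h1, h2⟩ := eq_zero_of_unitCircle_pair σ (hσ _) (hσ _)
            (hinj fun he => h02 (by rw [he])) hg.1
          simpa [h1, h2] using hg.2
      | cast j =>
        induction z using Fin.lastCases with
        | last =>
          simp only [extendedColumns, Fin.snoc_castSucc, Fin.snoc_last, Prod.smul_mk,
            Prod.mk_add_mk, Prod.mk_eq_zero, smul_zero, add_zero, smul_eq_mul, mul_one] at hg
          obtain ⟨h1, h2⟩ := eq_zero_of_unitCircle_pair σ (hσ _) (hσ _)
            (hinj fun he => h01 (by rw [he])) hg.1
          simpa [h1, h2] using hg.2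
        | cast k =>
          simp only [extendedColumns, Fin.snoc_castSucc, Prod.smul_mk,
            Prod.mk_add_mk, Prod.mk_eq_zero, smul_eq_mul, mul_one] at hg
          exact eq_zero_of_unitCircle_triple σ (hσ _) (hσ _) (hσ _)
            (hinj' fun he => h01 (by rw [he])) (hinj' fun he => h02 (by rw [he]))
            (hinj' fun he => h12 (by rw [he])) hg.2 hg.1
  intro k
  fin_cases k
  exacts [hall.1, hall.2.1, hall.2.2]

end UnitCircle

/-! ### The roots of unity and the main theorem -/

/-- A power `α ^ (q - 1)` of a primitive element of a quadratic extension of a field with `q`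
elements is a primitive `(q + 1)`-th root of unity. -/
lemma isPrimitiveRoot_pow_card_sub_one {F K : Type*} [Field F] [Finite F] [Field K] [Algebra F K]
    (hK : Module.finrank F K = 2) (α : Kˣ) (hα : ∀ x : Kˣ, x ∈ Subgroup.zpowers α) :
    IsPrimitiveRoot ((α : K) ^ (Nat.card F - 1)) (Nat.card F + 1) := by
  have : FiniteDimensional F K := Module.finite_of_finrank_eq_succ hK
  have : Finite K := Module.finite_of_finite F
  have hone : 1 < Nat.card F := Finite.one_lt_card
  have hcard : Nat.card K = Nat.card F ^ 2 := by rw [Module.natCard_eq_pow_finrank (K := F), hK]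
  have hord : orderOf α = (Nat.card F - 1) * (Nat.card F + 1) := by
    rw [orderOf_eq_card_of_forall_mem_zpowers hα, Nat.card_units, hcard, mul_comm,
      ← Nat.sq_sub_sq, one_pow]
  have hprim : IsPrimitiveRoot (α : K) (orderOf α) :=
    IsPrimitiveRoot.coe_units_iff.mpr (IsPrimitiveRoot.orderOf α)
  exact hprim.pow (orderOf_pos α) hord

theorem mainTheorem12 {F K : Type*} [Field F] [Finite F] [DecidableEq F] [Field K] [Algebra F K]
    (m q u : ℕ) (hm : 2 ≤ m) (hq : q = 2 ^ m) (hu : u = 2 ^ (m - 1))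
    (hF : Nat.card F = q) (hK : Module.finrank F K = 2)
    (α : Kˣ) (hα : ∀ x : Kˣ, x ∈ Subgroup.zpowers α)
    (β : K) (hβ : β = (α : K) ^ (q - 1)) :
    (IsLinearCode (q + 1) (q - 1) 3 (codeC F q u β) ∧
      IsMDSCode (q + 1) (codeC F q u β)) ∧
    (IsLinearCode (q + 1) 2 q (dualCode (codeC F q u β)) ∧
      IsMDSCode (q + 1) (dualCode (codeC F q u β))) ∧
    (IsLinearCode (q + 2) (q - 1) 4 (extendedCode (codeC F q u β)) ∧
      IsMDSCode (q + 2) (extendedCode (codeC F q u β))) ∧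
    (IsLinearCode (q + 2) 3 q (dualCode (extendedCode (codeC F q u β))) ∧
      IsMDSCode (q + 2) (dualCode (extendedCode (codeC F q u β))) ∧
      IsHyperovalCode q (dualCode (extendedCode (codeC F q u β)))) := by
  have : FiniteDimensional F K := Module.finite_of_finrank_eq_succ hK
  have hq2u : q = 2 * u := by rw [hq, hu, ← pow_succ']; congr 1; omega
  have hq4 : 4 ≤ q := by
    rw [hq]; exact (show 4 = 2 ^ 2 by norm_num) ▸ Nat.pow_le_pow_right (by norm_num) hm
  have hβp : IsPrimitiveRoot β (q + 1) := by
    rw [hβ, ← hF]; exact isPrimitiveRoot_pow_card_sub_one hK α hα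
  have hcop : Nat.Coprime u (q + 1) := by
    rw [hq2u, mul_comm, add_comm]; simp
  have hγp : IsPrimitiveRoot (β ^ u) (q + 1) := hβp.pow_of_coprime u hcop
  have hcop2 : Nat.Coprime 2 (q + 1) := by
    rw [hq2u, add_comm]; simp
  have hγ2 : IsPrimitiveRoot ((β ^ u) ^ 2) (q + 1) := hγp.pow_of_coprime 2 hcop2
  have hC : codeC F q u β = kernelCode fun i : Fin (q + 1) => (β ^ u) ^ (i : ℕ) := by
    -- The product defining `g_u` has a single factor.
    have hhalf : (q + 1) / 2 = u := by omega
    rw [codeC, genPoly, hhalf, Finset.Icc_self, Finset.prod_singleton,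
      cyclicCode_minpoly hγp.pow_eq_one]
  let _ : Fintype F := Fintype.ofFinite F
  have hσ : ∀ i : Fin (q + 1), (β ^ u) ^ (i : ℕ) *
      FiniteField.frobeniusAlgHom F K ((β ^ u) ^ (i : ℕ)) = 1 := fun i => by
    rw [FiniteField.frobeniusAlgHom_apply, Fintype.card_eq_nat_card, hF, ← pow_succ',
      ← pow_mul, mul_comm, pow_mul, hγp.pow_eq_one, one_pow]
  have hsq : Function.Injective fun i : Fin (q + 1) => ((β ^ u) ^ (i : ℕ)) ^ 2 := fun i j hij => by
    simp only [← pow_mul _ _ 2, mul_comm _ 2] at hij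
    rw [pow_mul, pow_mul _ 2] at hij
    exact Fin.ext (hγ2.pow_inj i.2 j.2 hij)
  have h2 := anyIndependent_two_of_unitCircle (F := F) _ hσ hsq
  have h3 := anyIndependent_three_of_unitCircle (F := F) _ hσ hsq
  have hK3 : Module.finrank F (K × F) = 3 := by rw [Module.finrank_prod, hK, Module.finrank_self]
  rw [hC, extendedCode_kernelCode]
  have c1 := h2.isLinearCode_kernelCode hK (by omega)
  have c2 := h2.isLinearCode_dualCode hK (by omega) (by omega)
  have c3 := h3.isLinearCode_kernelCode hK3 (by omega)
  have c4 := h3.isLinearCode_dualCode hK3 (by omega) (by omega)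
  rw [show q + 1 - 2 = q - 1 by omega] at c1
  rw [show q + 1 + 1 - 2 = q by omega] at c2
  rw [show q + 1 + 1 - 3 = q - 1 by omega] at c3
  rw [show q + 1 + 1 + 1 - 3 = q by omega] at c4
  exact ⟨⟨c1, _, _, by omega, by omega, by omega, c1⟩,
    ⟨c2, _, _, by omega, by omega, by omega, c2⟩,
    ⟨c3, _, _, by omega, by omega, by omega, c3⟩,
    c4, ⟨_, _, by omega, by omega, by omega, c4⟩, hF, ⟨m, hq⟩, c4⟩
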